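/- Let $G=(V,E)$ be a finite bridgeless cubic graph; loops are not allowed, parallel edges are allowed, and $G$ need not be connected. For $S\subseteq V$ let $\delta(S)\subseteq E$ be the set of edges with one end in $S$ and the other in $V\setminus S$; such a set is called a cut. A $3$-cut is a cut with exactly three edges that contains no nonempty cut as a proper subset. A $3$-cut perfect matching is a perfect matching of $G$ that meets every $3$-cut of $G$ in exactly one edge. For $F\subseteq E$ let $\chi^F\in\{0,1\}^E$ denote the incidence vector of $F$. Then $\frac13\chi^E$ is a convex combination of incidence vectors of $3$-cut perfect matchings; that is, there exist a natural number $k$, $3$-cut perfect matchings $M_1,\dots,M_k$ of $G$, and positive real numbers $\lambda_1,\dots,\lambda_k$ such that \[ \tfrac13\chi^E=\sum_{i=1}^k\lambda_i\chi^{M_i}\qquad\text{and}\qquad\sum_{i=1}^k\lambda_i=1 . \] -/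

import Mathlib

namespace Graph

variable {α β : Type*}

/-- A (loopless) graph is cubic if every vertex is an end of exactly three edges. Parallel edges
are counted separately. -/
def IsCubic (G : Graph α β) : Prop :=
  ∀ v ∈ G.vertexSet, (G.incidenceSet v).encard = 3

/-- An edge is a bridge if its two ends lie in different connected components of the graph
obtained by deleting that edge (only that one copy, if it has parallel copies). -/
def IsBridge (G : Graph α β) (e : β) : Prop :=
  ∃ x y, G.IsLink e x y ∧ ¬ Relation.ReflTransGen (G.deleteEdges {e}).Adj x y

/-- A graph is bridgeless if no edge is a bridge. -/
def IsBridgeless (G : Graph α β) : Prop :=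
  ∀ e ∈ G.edgeSet, ¬ G.IsBridge e

/-- `δ(S)`: the set of edges with one end in `S` and the other in `V \ S`. -/
def cut (G : Graph α β) (S : Set α) : Set β :=
  {e | ∃ x ∈ S, ∃ y ∈ G.vertexSet \ S, G.IsLink e x y}

/-- A set of edges is a cut if it is `δ(S)` for some set `S` of vertices. -/
def IsCut (G : Graph α β) (D : Set β) : Prop :=
  ∃ S ⊆ G.vertexSet, D = G.cut S

/-- A `k`-cut is a cut with `k` edges that is minimal: no nonempty cut is a proper subset of it. -/
def IsKCut (G : Graph α β) (k : ℕ) (D : Set β) : Prop :=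
  G.IsCut D ∧ D.encard = k ∧ ∀ D', G.IsCut D' → D'.Nonempty → ¬ D' ⊂ D

/-- A perfect matching of a (loopless) graph: a set of edges such that every vertex is an end of
exactly one of them. -/
def IsPerfectMatching (G : Graph α β) (M : Set β) : Prop :=
  M ⊆ G.edgeSet ∧ ∀ v ∈ G.vertexSet, ∃! e, e ∈ M ∧ G.Inc e v

/-- A 3-cut perfect matching: a perfect matching meeting every 3-cut in exactly one edge. -/
def IsThreeCutPerfectMatching (G : Graph α β) (M : Set β) : Prop :=
  G.IsPerfectMatching M ∧ ∀ D, G.IsKCut 3 D → (M ∩ D).encard = 1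

/-- The incidence vector `χ^F ∈ {0,1}^E ⊆ ℝ^E` of a set `F` of edges. -/
noncomputable def incidenceVector (G : Graph α β) (F : Set β) : G.edgeSet → ℝ :=
  fun e => F.indicator (fun _ => (1 : ℝ)) (e : β)

end Graph

/-!
The vector `χ^E / 3` satisfies Edmonds' inequalities for the perfect matching polytope: it is
nonnegative, sums to `1` at each vertex of a cubic graph, and an odd set `S` of vertices has an odd
number of edges in `δ(S)` (`Graph.IsCubic.odd_ncard_cut_iff`), hence at least three as there is no
bridge, so the sum over `δ(S)` is at least `1`. By Edmonds' theorem
(`Graph.matchingPolytope_subset_convexHull`) it is a convex combination of incidence vectors of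
perfect matchings. The two sides of a 3-cut `D` are odd, so all these matchings meet `D`; the
average of the numbers of edges in which they meet `D` is `3 / 3 = 1`, so each meets `D`
exactly once.

Edmonds' theorem is reduced by the Krein–Milman theorem
(`subset_convexHull_of_forall_exists_tight`) to the following: for each point `x` of the polytope
some perfect matching uses edges of positive weight only and meets each odd cut of `x`-weight `1`
(a tight cut) exactly once. Then the inequalities that are equations at `x` are equations at that
matching, and if `x` is an extreme point the two coincide.

Such a matching is found for weights on pairs of vertices, parallel edges being added up
(`IsFractionalPerfectMatching.exists_involutive_tight`); perfect matchings are then involutions of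
the vertex set. The proof is an induction on the number of vertices, with the stronger claim that
any given pair `u`, `v` of positive weight can be prescribed. If all tight cuts consist of the edges
at one vertex, Tutte's theorem for the graph without `u` and `v` gives the matching
(`IsFractionalPerfectMatching.exists_involutive`). Otherwise both sides of some tight cut are
contracted in turn, and matchings of the two contractions that use the same pair of the cut are put
together. That the result meets every tight cut once follows by uncrossing
(`IsFractionalPerfectMatching.exists_glue`).
-/

open Finset Filter Topology

/-! ### Weights on pairs of vertices and their cuts -/

section Weights
variable {V : Type*} [Fintype V] [DecidableEq V]

/-- The total weight of the pairs leaving `S`. -/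
def cutWeight (x : V → V → ℝ) (S : Finset V) : ℝ := ∑ a ∈ S, ∑ b ∈ Sᶜ, x a b

/-- Edmonds' description of the perfect matching polytope, for a weight `x` on the pairs of
vertices: `x` is symmetric, nonnegative, zero on the diagonal, has total weight `1` at every vertex
and at least `1` on every cut with an odd side. -/
structure IsFractionalPerfectMatching (x : V → V → ℝ) : Prop where
  symm : ∀ a b, x a b = x b a
  nonneg : ∀ a b, 0 ≤ x a b
  diag : ∀ a, x a a = 0
  sum_eq_one : ∀ a, ∑ b, x a b = 1
  one_le_cutWeight : ∀ S : Finset V, Odd #S → 1 ≤ cutWeight x S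

lemma cutWeight_compl {x : V → V → ℝ} (hx : ∀ a b, x a b = x b a) (S : Finset V) :
    cutWeight x Sᶜ = cutWeight x S := by
  unfold cutWeight
  rw [compl_compl, sum_comm]
  exact sum_congr rfl fun a _ => sum_congr rfl fun b _ => hx _ _

lemma cutWeight_singleton {x : V → V → ℝ} (hx : ∀ a, x a a = 0) (a : V) :
    cutWeight x {a} = ∑ b, x a b := by
  unfold cutWeight
  rw [sum_singleton, ← sum_compl_add_sum {a}, sum_singleton, hx, add_zero]

/-- Uncrossing: the cuts of `S` and `T` weigh as much as those of `S ∩ T` and `S ∪ T`, up to the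
pairs between `S \ T` and `T \ S`. -/
lemma cutWeight_add_cutWeight {x : V → V → ℝ} (hx : ∀ a b, x a b = x b a) (S T : Finset V) :
    cutWeight x S + cutWeight x T = cutWeight x (S ∩ T) + cutWeight x (S ∪ T) +
      2 * ∑ a ∈ S \ T, ∑ b ∈ T \ S, x a b := by
  have key : ∀ A B : Finset V, ∑ a ∈ A, ∑ b ∈ B, x a b =
      ∑ a, ∑ b, if a ∈ A ∧ b ∈ B then x a b else 0 := by
    intro A B
    simp [ite_and]
  have hsymm : ∑ a ∈ S \ T, ∑ b ∈ T \ S, x a b = ∑ a ∈ T \ S, ∑ b ∈ S \ T, x a b := by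
    rw [sum_comm]
    exact sum_congr rfl fun a _ => sum_congr rfl fun b _ => hx _ _
  rw [two_mul]
  nth_rw 2 [hsymm]
  simp only [cutWeight, key, ← sum_add_distrib]
  refine sum_congr rfl fun a _ => sum_congr rfl fun b _ => ?_
  by_cases ha : a ∈ S <;> by_cases hb : b ∈ S <;> by_cases ha' : a ∈ T <;> by_cases hb' : b ∈ T <;>
    simp [ha, hb, ha', hb']

namespace IsFractionalPerfectMatching
variable {x : V → V → ℝ}

lemma even_card (hx : IsFractionalPerfectMatching x) : Even (Fintype.card V) := by
  by_contra h
  have := hx.one_le_cutWeight univ (by simpa using h)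
  simp [cutWeight] at this
  linarith

lemma odd_card_compl (hx : IsFractionalPerfectMatching x) {S : Finset V} : Odd #Sᶜ ↔ Odd #S := by
  have h1 := card_add_card_compl S
  have h2 := hx.even_card
  rw [← h1, Nat.even_add] at h2
  rw [← Nat.not_even_iff_odd, ← Nat.not_even_iff_odd, h2]

end IsFractionalPerfectMatching

end Weights

/-! ### Matchings from Tutte's theorem -/

section Tutte
variable {V : Type*} [Fintype V] [DecidableEq V]
namespace IsFractionalPerfectMatching
variable {x : V → V → ℝ}

/-- After the deletion of a set `R` of vertices which contains a pair `u`, `v` of positive weight,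
the graph of the pairs of positive weight has fewer than `#R` odd components: each of them receives
weight at least `1` from `R`, and `R` has less than `#R` to give since `x u v > 0`. The remaining
vertices are indexed by `P`, and `comp` assigns components to them. -/
lemma card_odd_fibers_lt (hx : IsFractionalPerfectMatching x) {u v : V} (huv : 0 < x u v)
    {P C : Type*} [Fintype P] [DecidableEq C] (i : P ↪ V) (comp : P → C)
    (R : Finset V) (hu : u ∈ R) (hv : v ∈ R) (hR : ∀ a, a ∈ R ↔ ∀ p, i p ≠ a)
    (hcomp : ∀ p q, 0 < x (i p) (i q) → comp p = comp q)
    (𝒞 : Finset C) (hodd : ∀ c ∈ 𝒞, Odd #{p | comp p = c}) : #𝒞 < #R := by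
  have h1 : ∀ c ∈ 𝒞, 1 ≤ ∑ p with comp p = c, ∑ b ∈ R, x (i p) b := by
    intro c hc
    have h := hx.one_le_cutWeight (({p | comp p = c} : Finset P).map i) (by simpa using hodd c hc)
    refine h.trans ?_
    rw [cutWeight, sum_map]
    refine sum_le_sum fun p hp => ?_
    rw [← sum_filter_add_sum_filter_not _ (· ∈ R)]
    have h0 : ∑ b ∈ (({p | comp p = c} : Finset P).map i)ᶜ with b ∉ R, x (i p) b = 0 := by
      refine sum_eq_zero fun b hb => ?_
      rw [mem_filter, hR] at hb
      obtain ⟨hb, hb'⟩ := hb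
      push Not at hb'
      obtain ⟨q, rfl⟩ := hb'
      by_contra hne
      have := hcomp p q (lt_of_le_of_ne (hx.nonneg _ _) (Ne.symm hne))
      simp only [mem_filter, mem_univ, true_and] at hp
      simp [← this, hp] at hb
    rw [h0, add_zero]
    exact sum_le_sum_of_subset_of_nonneg (fun b hb => (mem_filter.1 hb).2)
      fun _ _ _ => hx.nonneg _ _
  have h2 : (#𝒞 : ℝ) ≤ ∑ p, ∑ b ∈ R, x (i p) b := by
    calc (#𝒞 : ℝ) = ∑ c ∈ 𝒞, 1 := by simp
      _ ≤ ∑ c ∈ 𝒞, ∑ p with comp p = c, ∑ b ∈ R, x (i p) b := sum_le_sum h1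
      _ = ∑ p with comp p ∈ 𝒞, ∑ b ∈ R, x (i p) b :=
        sum_fiberwise_eq_sum_filter _ _ _ _
      _ ≤ _ := sum_le_sum_of_subset_of_nonneg (filter_subset _ _)
        fun _ _ _ => sum_nonneg fun _ _ => hx.nonneg _ _
  have h3 : ∑ p, ∑ b ∈ R, x (i p) b = ∑ a ∈ Rᶜ, ∑ b ∈ R, x a b := by
    rw [← sum_map univ i (fun a => ∑ b ∈ R, x a b)]
    congr 1
    ext a
    simp [hR]
  have h4 : ∑ a ∈ Rᶜ, ∑ b ∈ R, x a b = #R - ∑ a ∈ R, ∑ b ∈ R, x a b := by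
    rw [eq_sub_iff_add_eq, sum_compl_add_sum, sum_comm]
    simp_rw [fun a b => hx.symm a b, hx.sum_eq_one]
    simp
  have h5 : 0 < ∑ a ∈ R, ∑ b ∈ R, x a b :=
    sum_pos' (fun _ _ => sum_nonneg fun _ _ => hx.nonneg _ _)
      ⟨u, hu, sum_pos' (fun _ _ => hx.nonneg _ _) ⟨v, hv, huv⟩⟩
  have : (#𝒞 : ℝ) < #R := by linarith
  exact_mod_cast this

/-- Every pair of positive weight belongs to a perfect matching, given as an involution, which uses
pairs of positive weight only. -/
lemma exists_involutive (hx : IsFractionalPerfectMatching x) {u v : V} (huv : 0 < x u v) :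
    ∃ f : V → V, f.Involutive ∧ f u = v ∧ ∀ a, 0 < x a (f a) := by
  classical
  have hne : u ≠ v := by
    rintro rfl
    exact huv.ne' (hx.diag u)
  let H : SimpleGraph {a // a ≠ u ∧ a ≠ v} :=
    { Adj := fun a b => 0 < x a b
      symm := ⟨fun a b h => by rwa [hx.symm]⟩
      loopless := ⟨fun a h => h.ne' (hx.diag a)⟩ }
  obtain ⟨M, hM⟩ : ∃ M : H.Subgraph, M.IsPerfectMatching := by
    rw [SimpleGraph.tutte]
    intro U hU
    rw [SimpleGraph.IsTutteViolator] at hU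
    set K := ((⊤ : H.Subgraph).deleteVerts U).coe
    let i : ((⊤ : H.Subgraph).deleteVerts U).verts ↪ V :=
      ⟨fun p => p.1.1, fun p q h => Subtype.ext (Subtype.ext h)⟩
    let R : Finset V := (univ.map i)ᶜ
    have hlt := hx.card_odd_fibers_lt huv i K.connectedComponentMk R
      (by simpa only [R, mem_compl, Finset.mem_map, not_exists] using fun p hp => p.1.2.1 hp.2)
      (by simpa only [R, mem_compl, Finset.mem_map, not_exists] using fun p hp => p.1.2.2 hp.2)
      (by simp [R])
      (by
        intro p q hpq
        refine SimpleGraph.ConnectedComponent.sound (SimpleGraph.Adj.reachable ?_)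
        have h : H.Adj p.1 q.1 := hpq
        simpa [K, SimpleGraph.Subgraph.deleteVerts_adj, p.2.2, q.2.2] using h)
      K.oddComponents.toFinset (by
        intro c hc
        rw [Set.mem_toFinset] at hc
        have h : Odd c.supp.ncard := hc
        rw [← Set.ncard_coe_finset]
        convert h using 3
        ext p
        simp)
    -- The graph without `u` and `v` has an even number of vertices, so a violator `U` leaves at
    -- least `U.ncard + 2` odd components, as many as there are deleted vertices.
    have hP : Nat.card ((⊤ : H.Subgraph).deleteVerts U).verts + U.ncard + 2 =
        Fintype.card V := by
      have h1 : ((⊤ : H.Subgraph).deleteVerts U).verts = Uᶜ := by ext; simp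
      have h2 : Fintype.card {a // a ≠ u ∧ a ≠ v} + 2 = Fintype.card V := by
        rw [Fintype.card_subtype, ← card_pair hne, ← card_add_card_compl {u, v}, add_comm]
        congr 2
        ext a
        simp
      rw [Nat.card_coe_set_eq, h1, add_comm _ U.ncard, Set.ncard_add_ncard_compl,
        Nat.card_eq_fintype_card, h2]
    have hR : #R + Nat.card ((⊤ : H.Subgraph).deleteVerts U).verts = Fintype.card V := by
      rw [card_compl, card_map, card_univ, Nat.card_eq_fintype_card]
      exact Nat.sub_add_cancel (Fintype.card_le_of_embedding i)
    have hpar := K.odd_ncard_oddComponents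
    have hev := hx.even_card
    rw [Set.ncard_eq_toFinset_card' K.oddComponents] at hU hpar
    rw [Nat.odd_iff, Nat.odd_iff] at hpar
    rw [Nat.even_iff] at hev
    omega
  have hM' := SimpleGraph.Subgraph.isPerfectMatching_iff.1 hM
  choose g hg hguniq using hM'
  have hgg : ∀ a, g (g a) = a := fun a => (hguniq _ _ (hg a).symm).symm
  refine ⟨fun a => if a = u then v else if a = v then u else
    if h : a ≠ u ∧ a ≠ v then g ⟨a, h⟩ else a, ?_, by simp, ?_⟩
  · intro a
    by_cases hu : a = u
    · simp [hu, hne.symm]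
    by_cases hv : a = v
    · simp [hv, hne.symm]
    have h1 := (g ⟨a, hu, hv⟩).2
    simp [hu, hv, h1, hgg]
  · intro a
    by_cases hu : a = u
    · simp [hu, huv]
    by_cases hv : a = v
    · subst hv
      simpa [hu, hx.symm a u] using huv
    have h2 : 0 < x a (g ⟨a, hu, hv⟩) := (hg ⟨a, hu, hv⟩).adj_sub
    simpa [hu, hv] using h2

end IsFractionalPerfectMatching
end Tutte

/-! ### Contraction -/

section Contraction
variable {V W : Type*} [Fintype V] [DecidableEq W]

/-- The weight on the pairs of `W` obtained by identifying the vertices in each fibre of `π`;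
pairs within a fibre are dropped. -/
def contractWeight (π : V → W) (x : V → V → ℝ) (w w' : W) : ℝ :=
  if w = w' then 0 else ∑ a with π a = w, ∑ b with π b = w', x a b

lemma exists_pos_of_contractWeight_pos {π : V → W} {x : V → V → ℝ} {w w' : W}
    (h : 0 < contractWeight π x w w') : ∃ a b, π a = w ∧ π b = w' ∧ 0 < x a b := by
  by_contra! hcon
  refine h.not_ge ?_
  unfold contractWeight
  split_ifs
  · rfl
  · exact sum_nonpos fun a ha => sum_nonpos fun b hb =>
      hcon a b (mem_filter.1 ha).2 (mem_filter.1 hb).2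

lemma contractWeight_pos {π : V → W} {x : V → V → ℝ} (hx : ∀ a b, 0 ≤ x a b) {a b : V}
    (hab : π a ≠ π b) (h : 0 < x a b) : 0 < contractWeight π x (π a) (π b) := by
  rw [contractWeight, if_neg hab]
  exact sum_pos' (fun _ _ => sum_nonneg fun _ _ => hx _ _)
    ⟨a, by simp, sum_pos' (fun _ _ => hx _ _) ⟨b, by simp, h⟩⟩

variable [DecidableEq V] [Fintype W]

lemma cutWeight_contractWeight (π : V → W) (x : V → V → ℝ) (T : Finset W) :
    cutWeight (contractWeight π x) T = cutWeight x {a | π a ∈ T} := by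
  unfold cutWeight contractWeight
  calc _ = ∑ w ∈ T, ∑ w' ∈ Tᶜ, ∑ a with π a = w, ∑ b with π b = w', x a b :=
        sum_congr rfl fun w hw => sum_congr rfl fun w' hw' =>
          if_neg (by rintro rfl; exact mem_compl.1 hw' hw)
    _ = ∑ w ∈ T, ∑ a with π a = w, ∑ w' ∈ Tᶜ, ∑ b with π b = w', x a b :=
        sum_congr rfl fun w _ => sum_comm
    _ = _ := by
        rw [sum_fiberwise_eq_sum_filter]
        simp_rw [sum_fiberwise_eq_sum_filter]
        congr! 2
        ext
        simp

/-- Edmonds' inequalities survive the contraction of odd sets whose cuts are tight: the cuts of the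
contraction are cuts of the original, with sides of the same parity. -/
lemma IsFractionalPerfectMatching.contract {x : V → V → ℝ}
    (hx : IsFractionalPerfectMatching x) (π : V → W) (hodd : ∀ w, Odd #{a | π a = w})
    (htight : ∀ w, cutWeight x {a | π a = w} = 1) :
    IsFractionalPerfectMatching (contractWeight π x) where
  symm w w' := by
    unfold contractWeight
    rw [sum_comm]
    simp only [eq_comm (a := w) (b := w'), hx.symm]
  nonneg w w' := by
    unfold contractWeight
    split_ifs
    · rfl
    · exact sum_nonneg fun _ _ => sum_nonneg fun _ _ => hx.nonneg _ _
  diag w := by simp [contractWeight]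
  sum_eq_one w := by
    rw [← cutWeight_singleton (by simp [contractWeight]), cutWeight_contractWeight]
    simpa using htight w
  one_le_cutWeight T hT := by
    rw [cutWeight_contractWeight]
    refine hx.one_le_cutWeight _ ?_
    rw [card_eq_sum_card_fiberwise (f := π) (t := T) (by intro; simp)]
    have hfib : ∀ w ∈ T, ({a ∈ ({a | π a ∈ T} : Finset V) | π a = w} : Finset V) =
        ({a | π a = w} : Finset V) := by
      intro w hw
      ext a
      simp only [mem_filter, mem_univ, true_and, and_iff_right_iff_imp]
      rintro rfl
      exact hw
    rw [sum_congr rfl fun w hw => congrArg card (hfib w hw), odd_sum_iff_odd_card_odd]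
    simpa [hodd] using hT

end Contraction

/-! ### Matchings of the two contractions of a tight cut -/

section Matching
variable {V : Type*} [DecidableEq V]

/-- The `0`-`1` weight of the perfect matching whose pairs are `a`, `f a`, for an involution `f`. -/
def matchingWeight (f : V → V) (a b : V) : ℝ := if f a = b then 1 else 0

lemma matchingWeight_symm {f : V → V} (hf : f.Involutive) (a b : V) :
    matchingWeight f a b = matchingWeight f b a := by
  simp only [matchingWeight, hf.eq_iff, eq_comm (a := a)]

/-- The map which keeps the vertices of `S` and sends all others to one new vertex. -/
def contractCompl (S : Finset V) (a : V) : Option {a // a ∈ S} :=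
  if h : a ∈ S then some ⟨a, h⟩ else none

lemma contractCompl_of_mem {S : Finset V} {a : V} (h : a ∈ S) :
    contractCompl S a = some ⟨a, h⟩ := dif_pos h

lemma contractCompl_of_notMem {S : Finset V} {a : V} (h : a ∉ S) :
    contractCompl S a = none := dif_neg h

lemma contractCompl_eq_some {S : Finset V} {a : V} {s : {a // a ∈ S}} :
    contractCompl S a = some s ↔ a = s := by
  unfold contractCompl
  split_ifs with h
  · simp [Subtype.ext_iff]
  · simp only [false_iff]
    rintro rfl
    exact h s.2

lemma contractCompl_eq_none {S : Finset V} {a : V} : contractCompl S a = none ↔ a ∉ S := by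
  unfold contractCompl
  split_ifs with h <;> simp [h]

lemma contractCompl_elim {S : Finset V} {b : V} (hb : b ∉ S) (o : Option {a // a ∈ S}) :
    contractCompl S (o.elim b (·.1)) = o := by
  cases o with
  | none => exact contractCompl_of_notMem hb
  | some s => exact contractCompl_of_mem s.2

variable [Fintype V]

lemma cutWeight_matchingWeight (f : V → V) (S : Finset V) :
    cutWeight (matchingWeight f) S = #{a ∈ S | f a ∉ S} := by
  simp [cutWeight, matchingWeight, card_filter]

lemma IsFractionalPerfectMatching.contract_compl {x : V → V → ℝ}
    (hx : IsFractionalPerfectMatching x) {S : Finset V} (hS : Odd #S) (hx1 : cutWeight x S = 1) :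
    IsFractionalPerfectMatching (contractWeight (contractCompl S) x) := by
  have h0 : ({a | contractCompl S a = none} : Finset V) = Sᶜ := by
    ext; simp [contractCompl_eq_none]
  have h1 : ∀ s : {a // a ∈ S}, ({a | contractCompl S a = some s} : Finset V) = {s.1} := by
    intro s; ext; simp [contractCompl_eq_some]
  refine hx.contract _ ?_ ?_
  · rintro (_ | s)
    · rw [h0]
      exact hx.odd_card_compl.2 hS
    · simp [h1]
  · rintro (_ | s)
    · rw [h0, cutWeight_compl hx.symm, hx1]
    · rw [h1, cutWeight_singleton hx.diag, hx.sum_eq_one]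

/-- The properties which `f` has on `S` when it is put together from an involution `g` of the
contraction of `Sᶜ` and an involution of the contraction of `S`, the two being joined
along `a` and `b`. -/
lemma glue_on_side {x : V → V → ℝ} {S : Finset V} {a b : V} (ha : a ∈ S) (hb : b ∉ S)
    (hab : 0 < x a b) {f : V → V} {g : Option {a // a ∈ S} → Option {a // a ∈ S}}
    (hg : g.Involutive) (hga : g (contractCompl S a) = none)
    (hpos : ∀ p, 0 < contractWeight (contractCompl S) x p (g p))
    (htight : ∀ T, Odd #T → cutWeight (contractWeight (contractCompl S) x) T = 1 →
      cutWeight (matchingWeight g) T = 1)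
    (hf : ∀ v ∈ S, f v = (g (contractCompl S v)).elim b (·.1)) (hfb : f b = a) :
    (∀ v ∈ S, f (f v) = v) ∧ (∀ v ∈ S, 0 < x v (f v)) ∧
      ∀ T ⊆ S, Odd #T → cutWeight x T = 1 → cutWeight (matchingWeight f) T = 1 := by
  have hcases : ∀ v (hv : v ∈ S), (v = a ∧ f v = b) ∨
      ∃ s : {a // a ∈ S}, g (some ⟨v, hv⟩) = some s ∧ f v = s := by
    intro v hv
    rw [hf v hv, contractCompl_of_mem hv]
    cases h : g (some ⟨v, hv⟩) with
    | none =>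
      left
      rw [← hga, contractCompl_of_mem ha, hg.injective.eq_iff] at h
      simpa using h
    | some s => exact Or.inr ⟨s, rfl, rfl⟩
  refine ⟨fun v hv => ?_, fun v hv => ?_, fun T hTS hT hT1 => ?_⟩
  · obtain ⟨rfl, h⟩ | ⟨s, h, h'⟩ := hcases v hv
    · rw [h, hfb]
    · rw [h', hf s s.2, contractCompl_of_mem s.2, Subtype.coe_eta, ← h, hg]
      rfl
  · obtain ⟨rfl, h⟩ | ⟨s, h, h'⟩ := hcases v hv
    · rwa [h]
    · obtain ⟨c, d, hc, hd, hcd⟩ := exists_pos_of_contractWeight_pos (hpos (some ⟨v, hv⟩))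
      rw [h, contractCompl_eq_some] at hd
      rw [contractCompl_eq_some] at hc
      rwa [h', ← hd, ← (show c = v from hc)]
  · have hinj : Set.InjOn (contractCompl S) T := by
      intro c hc d hd h
      rw [contractCompl_of_mem (hTS hd), contractCompl_eq_some] at h
      exact h
    have hmem : ∀ c, contractCompl S c ∈ T.image (contractCompl S) ↔ c ∈ T := by
      intro c
      refine ⟨fun h => ?_, fun h => mem_image_of_mem _ h⟩
      obtain ⟨d, hd, h⟩ := mem_image.1 h
      rw [eq_comm, contractCompl_of_mem (hTS hd), contractCompl_eq_some] at h
      exact h ▸ hd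
    have h := htight (T.image (contractCompl S)) (by rwa [card_image_of_injOn hinj])
      (by rw [cutWeight_contractWeight]; simpa [hmem] using hT1)
    rw [cutWeight_matchingWeight] at h ⊢
    rw [← h, filter_image, card_image_of_injOn (hinj.mono (coe_subset.2 (filter_subset _ _)))]
    congr 2
    refine filter_congr fun v hv => ?_
    rw [← hmem, hf v (hTS hv), contractCompl_elim hb]

end Matching

section Gluing
variable {V : Type*} [Fintype V] [DecidableEq V]

/-- Involutions of the two contractions of a tight cut `δ(S)` which use the same pair `a`, `b` of
that cut combine to an involution of the whole vertex set. Each tight cut uncrosses with `δ(S)`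
into two tight cuts not crossing `δ(S)`. -/
lemma IsFractionalPerfectMatching.exists_glue {x : V → V → ℝ}
    (hx : IsFractionalPerfectMatching x) {S S' : Finset V} (hSS' : Sᶜ = S') (hS : Odd #S)
    (hS1 : cutWeight x S = 1) {a b : V} (ha : a ∈ S) (hb : b ∈ S') (hab : 0 < x a b)
    {g : Option {a // a ∈ S} → Option {a // a ∈ S}} (hg : g.Involutive)
    (hga : g (contractCompl S a) = none)
    (hgpos : ∀ p, 0 < contractWeight (contractCompl S) x p (g p))
    (hgtight : ∀ T, Odd #T →
      cutWeight (contractWeight (contractCompl S) x) T = 1 →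
      cutWeight (matchingWeight g) T = 1)
    {g' : Option {a // a ∈ S'} → Option {a // a ∈ S'}} (hg' : g'.Involutive)
    (hgb' : g' (contractCompl S' b) = none)
    (hgpos' : ∀ p, 0 < contractWeight (contractCompl S') x p (g' p))
    (hgtight' : ∀ T, Odd #T →
      cutWeight (contractWeight (contractCompl S') x) T = 1 →
      cutWeight (matchingWeight g') T = 1) :
    ∃ f : V → V, f.Involutive ∧ (∀ v ∈ S, f v = (g (contractCompl S v)).elim b (·.1)) ∧
      (∀ v, 0 < x v (f v)) ∧
      ∀ T, Odd #T → cutWeight x T = 1 → cutWeight (matchingWeight f) T = 1 := by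
  have hmem : ∀ v, v ∈ S' ↔ v ∉ S := fun v => by rw [← hSS', mem_compl]
  let f : V → V := fun v => if v ∈ S then (g (contractCompl S v)).elim b (·.1) else
    (g' (contractCompl S' v)).elim a (·.1)
  have hf : ∀ v ∈ S, f v = (g (contractCompl S v)).elim b (·.1) := fun v hv => if_pos hv
  have hf' : ∀ v ∈ S', f v = (g' (contractCompl S' v)).elim a (·.1) :=
    fun v hv => if_neg ((hmem v).1 hv)
  have hfa : f a = b := by rw [hf a ha, hga]; rfl
  have hfb : f b = a := by rw [hf' b hb, hgb']; rfl
  obtain ⟨h1, h2, h3⟩ := glue_on_side ha ((hmem b).1 hb) hab hg hga hgpos hgtight hf hfb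
  obtain ⟨h1', h2', h3'⟩ := glue_on_side hb (fun h => (hmem a).1 h ha) (by rwa [hx.symm]) hg' hgb'
    hgpos' hgtight' hf' hfa
  have hinv : f.Involutive := fun v =>
    if h : v ∈ S then h1 v h else h1' v ((hmem v).2 h)
  have hfpos : ∀ v, 0 < x v (f v) := fun v => if h : v ∈ S then h2 v h else h2' v ((hmem v).2 h)
  refine ⟨f, hinv, hf, hfpos, ?_⟩
  have hfsymm := matchingWeight_symm hinv
  -- If `S ∩ T` is odd, then `S ∩ T` and `S ∪ T` are tight and no weight lies between
  -- `S \ T` and `T \ S`.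
  have key : ∀ T : Finset V, Odd #(S ∩ T) → Odd #T → cutWeight x T = 1 →
      cutWeight (matchingWeight f) T = 1 := by
    intro T hST hT hT1
    have hunion : Odd #(S ∪ T) := by
      have := card_union_add_card_inter S T
      rw [Nat.odd_iff] at *
      omega
    have hu := cutWeight_add_cutWeight hx.symm S T
    have hi1 := hx.one_le_cutWeight _ hST
    have hu1 := hx.one_le_cutWeight _ hunion
    have hnn : 0 ≤ ∑ a ∈ S \ T, ∑ b ∈ T \ S, x a b :=
      sum_nonneg fun _ _ => sum_nonneg fun _ _ => hx.nonneg _ _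
    have hzero : ∑ a ∈ S \ T, ∑ b ∈ T \ S, x a b = 0 := by linarith
    have hzero' : ∑ a ∈ S \ T, ∑ b ∈ T \ S, matchingWeight f a b = 0 := by
      refine sum_eq_zero fun c hc => sum_eq_zero fun d hd => ?_
      rw [sum_eq_zero_iff_of_nonneg fun _ _ => sum_nonneg fun _ _ => hx.nonneg _ _] at hzero
      have h := hzero c hc
      rw [sum_eq_zero_iff_of_nonneg fun _ _ => hx.nonneg _ _] at h
      refine if_neg fun hcd => ?_
      have := hfpos c
      rw [hcd, h d hd] at this
      exact this.false
    have e1 := h3 S subset_rfl hS hS1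
    have e2 := h3 (S ∩ T) inter_subset_left hST (by linarith)
    have e3 := h3' (S ∪ T)ᶜ (by
        rw [← hSS']; exact compl_subset_compl.2 subset_union_left) (hx.odd_card_compl.2 hunion)
      (by rw [cutWeight_compl hx.symm]; linarith)
    rw [cutWeight_compl hfsymm] at e3
    have e4 := cutWeight_add_cutWeight hfsymm S T
    linarith
  intro T hT hT1
  by_cases hST : Odd #(S ∩ T)
  · exact key T hST hT hT1
  -- Otherwise `S ∩ Tᶜ` is odd, and `Tᶜ` has the same cut as `T`.
  · rw [← cutWeight_compl hfsymm]
    refine key Tᶜ ?_ (hx.odd_card_compl.2 hT) (by rwa [cutWeight_compl hx.symm])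
    have h := card_inter_add_card_sdiff S T
    rw [sdiff_eq_inter_compl] at h
    rw [Nat.odd_iff] at *
    omega

end Gluing

/-- Each pair of positive weight belongs to a perfect matching which uses pairs of positive weight
only and meets every tight odd cut in exactly one pair. -/
theorem IsFractionalPerfectMatching.exists_involutive_tight {V : Type*} [Fintype V]
    [DecidableEq V] {x : V → V → ℝ} (hx : IsFractionalPerfectMatching x) {u v : V}
    (huv : 0 < x u v) :
    ∃ f : V → V, f.Involutive ∧ f u = v ∧ (∀ a, 0 < x a (f a)) ∧
      ∀ S, Odd #S → cutWeight x S = 1 → cutWeight (matchingWeight f) S = 1 := by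
  induction hn : Fintype.card V using Nat.strong_induction_on generalizing V with
  | _ n ih =>
  subst hn
  by_cases hS : ∃ S : Finset V, Odd #S ∧ cutWeight x S = 1 ∧ 1 < #S ∧ 1 < #Sᶜ
  · obtain ⟨S, hu, hS, hS1, hS2, hS3⟩ : ∃ S : Finset V, u ∈ S ∧ Odd #S ∧ cutWeight x S = 1 ∧
        1 < #S ∧ 1 < #Sᶜ := by
      obtain ⟨S, hS, hS1, hS2, hS3⟩ := hS
      by_cases hu : u ∈ S
      · exact ⟨S, hu, hS, hS1, hS2, hS3⟩
      · exact ⟨Sᶜ, mem_compl.2 hu, hx.odd_card_compl.2 hS, by rwa [cutWeight_compl hx.symm],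
          hS3, by rwa [compl_compl]⟩
    have hcard := card_add_card_compl S
    have half : ∀ R : Finset V, Odd #R → cutWeight x R = 1 → 1 < #Rᶜ → ∀ {c d : V}, 0 < x c d →
        contractCompl R c ≠ contractCompl R d → ∃ g, g.Involutive ∧
        g (contractCompl R c) = contractCompl R d ∧
        (∀ p, 0 < contractWeight (contractCompl R) x p (g p)) ∧
        ∀ T, Odd #T → cutWeight (contractWeight (contractCompl R) x) T = 1 →
          cutWeight (matchingWeight g) T = 1 := by
      intro R hR hR1 hR2 c d hcd hne
      refine ih _ ?_ (hx.contract_compl hR hR1) (contractWeight_pos hx.nonneg hne hcd) rfl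
      have := card_add_card_compl R
      rw [Fintype.card_option, Fintype.card_coe]
      omega
    have hne : contractCompl S u ≠ contractCompl S v := by
      rw [contractCompl_of_mem hu, ne_comm, Ne, contractCompl_eq_some]
      rintro h
      exact huv.ne' (h ▸ hx.diag u)
    obtain ⟨g, hg, hgu, hgpos, hgtight⟩ := half S hS hS1 hS3 huv hne
    -- The pair along which the two sides are joined: `u`, `v` itself if it lies in the cut.
    obtain ⟨a, b, ha, hb, hab, hga, hbv⟩ : ∃ a b, a ∈ S ∧ b ∉ S ∧ 0 < x a b ∧
        g (contractCompl S a) = none ∧ (v ∉ S → b = v) := by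
      by_cases hv : v ∈ S
      · obtain ⟨b, a, hb, ha, hba⟩ := exists_pos_of_contractWeight_pos (hgpos none)
        refine ⟨a, b, ?_, contractCompl_eq_none.1 hb, by rwa [hx.symm], by rw [ha, hg],
          fun h => (h hv).elim⟩
        by_contra haS
        have h := hgpos none
        rw [← ha, contractCompl_of_notMem haS, (hx.contract_compl hS hS1).diag] at h
        exact h.false
      · exact ⟨u, v, hu, hv, huv, by rw [hgu, contractCompl_of_notMem hv], fun _ => rfl⟩
    have haS : a ∉ Sᶜ := fun h => mem_compl.1 h ha
    obtain ⟨g', hg', hgb', hgpos', hgtight'⟩ := half Sᶜ (hx.odd_card_compl.2 hS)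
      (by rwa [cutWeight_compl hx.symm]) (by rwa [compl_compl]) (c := b) (d := a)
      (by rwa [hx.symm]) (by
        rw [contractCompl_of_mem (mem_compl.2 hb), contractCompl_of_notMem haS]
        exact Option.some_ne_none _)
    rw [contractCompl_of_notMem haS] at hgb'
    obtain ⟨f, hf, hfS, hfpos, hftight⟩ := hx.exists_glue rfl hS hS1 ha (mem_compl.2 hb) hab hg hga
      hgpos hgtight hg' hgb' hgpos' hgtight'
    refine ⟨f, hf, ?_, hfpos, hftight⟩
    rw [hfS u hu, hgu]
    by_cases hv : v ∈ S
    · rw [contractCompl_of_mem hv]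
      rfl
    · rw [contractCompl_of_notMem hv]
      exact hbv hv
  · push Not at hS
    obtain ⟨f, hf, hfu, hfpos⟩ := hx.exists_involutive huv
    have hsingle : ∀ S : Finset V, #S = 1 → cutWeight (matchingWeight f) S = 1 := by
      intro S hS
      obtain ⟨a, rfl⟩ := card_eq_one.1 hS
      rw [cutWeight_singleton, sum_eq_single (f a)]
      · simp [matchingWeight]
      · exact fun b _ hb => if_neg hb.symm
      · simp
      · intro b
        refine if_neg fun h => ?_
        have := hfpos b
        rw [h, hx.diag] at this
        exact this.false
    refine ⟨f, hf, hfu, hfpos, fun S hSodd hS1 => ?_⟩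
    have h1 : 1 ≤ #S := hSodd.pos
    have h2 : 1 ≤ #Sᶜ := (hx.odd_card_compl.2 hSodd).pos
    obtain h | h := h1.eq_or_lt
    · exact hsingle S h.symm
    · rw [← cutWeight_compl (matchingWeight_symm hf)]
      exact hsingle _ (le_antisymm (hS S hSodd hS1 h) h2)

/-! ### Polytopes with given points on their faces -/

section Polytope
variable {ι κ : Type*} [Finite ι] [Fintype κ]

/-- A polytope is the convex hull of a finite set `P` of its points if each of its points `x` lies
on a face that contains a point of `P` and is as small as possible, that is, each inequality which
is an equation at `x` is one at that point as well. -/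
theorem subset_convexHull_of_forall_exists_tight (A : ι → κ → ℝ) (c : ι → ℝ)
    (hbdd : Bornology.IsBounded {x : κ → ℝ | ∀ i, c i ≤ A i ⬝ᵥ x}) {P : Set (κ → ℝ)}
    (hPfin : P.Finite) (hP : ∀ p ∈ P, ∀ i, c i ≤ A i ⬝ᵥ p)
    (htight : ∀ x, (∀ i, c i ≤ A i ⬝ᵥ x) → ∃ p ∈ P, ∀ i, A i ⬝ᵥ x = c i → A i ⬝ᵥ p = c i) :
    {x : κ → ℝ | ∀ i, c i ≤ A i ⬝ᵥ x} ⊆ convexHull ℝ P := by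
  set Q := {x : κ → ℝ | ∀ i, c i ≤ A i ⬝ᵥ x} with hQ
  have hclosed : IsClosed Q := by
    rw [hQ, Set.ofPred_forall]
    refine isClosed_iInter fun i => isClosed_le continuous_const ?_
    exact Continuous.dotProduct continuous_const continuous_id
  have hconv : Convex ℝ Q := by
    intro x hx y hy s t hs ht hst i
    rw [dotProduct_add, dotProduct_smul, dotProduct_smul, smul_eq_mul, smul_eq_mul]
    calc c i = s * c i + t * c i := by rw [← add_mul, hst, one_mul]
      _ ≤ _ := add_le_add (mul_le_mul_of_nonneg_left (hx i) hs)
        (mul_le_mul_of_nonneg_left (hy i) ht)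
  have hcompact : IsCompact Q := Metric.isCompact_of_isClosed_isBounded hclosed hbdd
  have hext : Q.extremePoints ℝ ⊆ P := by
    intro x hx
    obtain ⟨p, hp, hpt⟩ := htight x hx.1
    -- A small step from `x` away from `p` stays in the polytope.
    have hev : ∀ᶠ t : ℝ in 𝓝[>] 0, ∀ i, c i ≤ A i ⬝ᵥ (x + t • (x - p)) := by
      rw [eventually_all]
      intro i
      simp_rw [dotProduct_add, dotProduct_smul, dotProduct_sub, smul_eq_mul]
      obtain h | h := (hx.1 i).eq_or_lt
      · simp [← h, hpt i h.symm]
      · refine Tendsto.eventually_const_le h ?_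
        have : Continuous fun t : ℝ => A i ⬝ᵥ x + t * (A i ⬝ᵥ x - A i ⬝ᵥ p) := by fun_prop
        simpa using (this.tendsto 0).mono_left nhdsWithin_le_nhds
    obtain ⟨t, ht, ht0⟩ := (hev.and self_mem_nhdsWithin).exists
    have ht0 : 0 < t := ht0
    have hpx : p = x := by
      refine hx.2 (hP p hp) ht ⟨t / (1 + t), 1 / (1 + t), by positivity, by positivity,
        by field_simp; ring, ?_⟩
      ext k
      simp only [Pi.add_apply, Pi.smul_apply, Pi.sub_apply, smul_eq_mul]
      field_simp
      ring
    exact hpx ▸ hp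
  calc Q = closure (convexHull ℝ (Q.extremePoints ℝ)) :=
        (closure_convexHull_extremePoints hcompact hconv).symm
    _ ⊆ closure (convexHull ℝ P) := closure_mono (convexHull_mono hext)
    _ = convexHull ℝ P := (hPfin.isClosed_convexHull ℝ).closure_eq

end Polytope

/-! ### Parity of cuts -/

section Parity
variable {V : Type*} [Fintype V] [DecidableEq V]

/-- If all degrees of a multigraph without loops are odd, then a cut is odd if and only if its
sides are. -/
lemma odd_sum_compl_iff {n : V → V → ℕ} (hsymm : ∀ a b, n a b = n b a) (hdiag : ∀ a, n a a = 0)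
    (hodd : ∀ a, Odd (∑ b, n a b)) (S : Finset V) :
    Odd (∑ a ∈ S, ∑ b ∈ Sᶜ, n a b) ↔ Odd #S := by
  have h1 : ((∑ a ∈ S, ∑ b ∈ S, n a b : ℕ) : ZMod 2) = 0 := by
    rw [← sum_product']
    push_cast
    refine sum_involution (fun p _ => p.swap) ?_ ?_ (by simp [and_comm]) (by simp)
    · rintro ⟨a, b⟩ -
      simp only [Prod.swap, hsymm b a]
      exact CharTwo.add_self_eq_zero _
    · rintro ⟨a, b⟩ - h h'
      simp only [Prod.swap, Prod.mk.injEq] at h'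
      simp [h'.1, hdiag] at h
  have h2 : ((∑ a ∈ S, ∑ b, n a b : ℕ) : ZMod 2) = #S := by
    push_cast
    have : ∀ a, (∑ b, (n a b : ZMod 2)) = 1 := fun a => by
      exact_mod_cast (ZMod.natCast_eq_one_iff_odd).2 (hodd a)
    simp [this]
  have h3 : ∑ a ∈ S, ∑ b, n a b = ∑ a ∈ S, ∑ b ∈ S, n a b + ∑ a ∈ S, ∑ b ∈ Sᶜ, n a b := by
    simp_rw [← sum_add_distrib, sum_add_sum_compl]
  rw [h3, Nat.cast_add, h1, zero_add] at h2
  rw [← ZMod.natCast_eq_one_iff_odd, h2, ZMod.natCast_eq_one_iff_odd]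

lemma one_le_cutWeight_matchingWeight {f : V → V} (hf : f.Involutive) (hne : ∀ a, f a ≠ a)
    {S : Finset V} (hS : Odd #S) : 1 ≤ cutWeight (matchingWeight f) S := by
  have h := (odd_sum_compl_iff (n := fun a b => if f a = b then 1 else 0)
    (fun a b => by simp only [hf.eq_iff, eq_comm (a := a)]) (by simp [hne]) (by simp) S).2 hS
  have : cutWeight (matchingWeight f) S =
      (∑ a ∈ S, ∑ b ∈ Sᶜ, if f a = b then 1 else 0 : ℕ) := by
    push_cast
    rfl
  rw [this]
  exact_mod_cast h.pos

end Parity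

/-! ### The perfect matching polytope of a multigraph -/

namespace Graph
variable {α β : Type*} {G : Graph α β}

section Polytope

lemma mem_cut_image {S : Set G.vertexSet} {e : β} :
    e ∈ G.cut (Subtype.val '' S) ↔ ∃ a ∈ S, ∃ b ∉ S, G.IsLink e a b := by
  constructor
  · rintro ⟨_, ⟨a, ha, rfl⟩, b, ⟨hb, hb'⟩, h⟩
    exact ⟨a, ha, ⟨b, hb⟩, fun hS => hb' ⟨_, hS, rfl⟩, h⟩
  · rintro ⟨a, ha, b, hb, h⟩
    refine ⟨a, ⟨a, ha, rfl⟩, b, ⟨b.2, ?_⟩, h⟩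
    rintro ⟨c, hc, hcb⟩
    exact hb (Subtype.ext hcb ▸ hc)

lemma mem_cut_singleton [G.Loopless] {a : G.vertexSet} {e : β} :
    e ∈ G.cut (Subtype.val '' ({a} : Set G.vertexSet)) ↔ G.Inc e a := by
  rw [mem_cut_image]
  constructor
  · rintro ⟨_, rfl, b, -, h⟩
    exact h.inc_left
  · rintro ⟨b, h⟩
    exact ⟨a, rfl, ⟨b, h.right_mem⟩, fun hb => h.ne (congrArg Subtype.val hb).symm, h⟩

variable [Fintype G.edgeSet]

open Classical in
/-- The total weight of the edges joining two given vertices, for a weight `x` on the edges. -/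
noncomputable def pairWeight (x : G.edgeSet → ℝ) (a b : G.vertexSet) : ℝ :=
  ∑ e : G.edgeSet, if G.IsLink (e : β) a b then x e else 0

lemma pairWeight_symm (x : G.edgeSet → ℝ) (a b : G.vertexSet) :
    pairWeight x a b = pairWeight x b a := by
  classical
  exact sum_congr rfl fun _ _ => if_congr G.isLink_comm rfl rfl

lemma pairWeight_self [G.Loopless] (x : G.edgeSet → ℝ) (a : G.vertexSet) :
    pairWeight x a a = 0 :=
  sum_eq_zero fun _ _ => if_neg fun h => h.ne rfl

lemma pairWeight_nonneg {x : G.edgeSet → ℝ} (hx : ∀ e, 0 ≤ x e) (a b : G.vertexSet) :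
    0 ≤ pairWeight x a b :=
  sum_nonneg fun e _ => by split_ifs <;> simp [hx]

lemma cutWeight_pairWeight [Fintype G.vertexSet] [DecidableEq G.vertexSet] (x : G.edgeSet → ℝ)
    (S : Finset G.vertexSet) :
    cutWeight (pairWeight x) S =
      G.incidenceVector (G.cut (Subtype.val '' (S : Set G.vertexSet))) ⬝ᵥ x := by
  classical
  have h1 : cutWeight (pairWeight x) S =
      ∑ e : G.edgeSet, ∑ p ∈ S ×ˢ Sᶜ, if G.IsLink (e : β) p.1 p.2 then x e else 0 := by
    rw [sum_comm, sum_product]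
    rfl
  rw [h1]
  refine sum_congr rfl fun e _ => ?_
  by_cases he : (e : β) ∈ G.cut (Subtype.val '' (S : Set G.vertexSet))
  · obtain ⟨a, ha, b, hb, h⟩ := mem_cut_image.1 he
    simp only [incidenceVector, Set.indicator_of_mem he, one_mul]
    rw [sum_eq_single (a, b)]
    · exact if_pos h
    · rintro ⟨c, d⟩ hcd hne
      rw [mem_product, mem_compl] at hcd
      refine if_neg fun h' => ?_
      obtain ⟨h1, h2⟩ | ⟨h1, h2⟩ := h.eq_and_eq_or_eq_and_eq h'
      · exact hne (Prod.ext (Subtype.ext h1.symm) (Subtype.ext h2.symm))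
      · exact hcd.2 (Subtype.ext h1 ▸ ha)
    · intro hab
      exact (hab (by simpa using ⟨ha, hb⟩)).elim
  · simp only [incidenceVector, Set.indicator_of_notMem he, zero_mul]
    refine sum_eq_zero fun p hp => if_neg fun h => he ?_
    rw [mem_product, mem_compl] at hp
    exact mem_cut_image.2 ⟨p.1, hp.1, p.2, hp.2, h⟩

variable (G) in
/-- The polytope of Edmonds' theorem: the edge weights which are nonnegative, sum to `1` over the
edges at each vertex and to at least `1` over each cut with an odd side. -/
def matchingPolytope : Set (G.edgeSet → ℝ) :=
  {x | (∀ e, 0 ≤ x e) ∧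
    (∀ a, G.incidenceVector (G.cut (Subtype.val '' ({a} : Set G.vertexSet))) ⬝ᵥ x = 1) ∧
    ∀ S : Finset G.vertexSet, Odd #S →
      1 ≤ G.incidenceVector (G.cut (Subtype.val '' (S : Set G.vertexSet))) ⬝ᵥ x}

lemma isFractionalPerfectMatching_pairWeight [G.Loopless] [Fintype G.vertexSet]
    [DecidableEq G.vertexSet] {x : G.edgeSet → ℝ} (hx : x ∈ G.matchingPolytope) :
    IsFractionalPerfectMatching (pairWeight x) where
  symm := pairWeight_symm x
  nonneg := pairWeight_nonneg hx.1
  diag := pairWeight_self x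
  sum_eq_one a := by
    rw [← cutWeight_singleton (pairWeight_self x), cutWeight_pairWeight, coe_singleton]
    exact hx.2.1 a
  one_le_cutWeight S hS := by
    rw [cutWeight_pairWeight]
    exact hx.2.2 S hS

/-- An involution along pairs of adjacent vertices comes from a perfect matching of the multigraph:
among the parallel edges between two vertices one of positive weight is chosen. -/
lemma exists_isPerfectMatching_of_involutive [DecidableEq G.vertexSet] {x : G.edgeSet → ℝ}
    {f : G.vertexSet → G.vertexSet} (hf : f.Involutive) (hpos : ∀ a, 0 < pairWeight x a (f a)) :
    ∃ M, G.IsPerfectMatching M ∧ (∀ e : G.edgeSet, (e : β) ∈ M → 0 < x e) ∧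
      pairWeight (G.incidenceVector M) = matchingWeight f := by
  classical
  have hex : ∀ z : Sym2 G.vertexSet, (∃ a, s(a, f a) = z) →
      ∃ e : G.edgeSet, 0 < x e ∧ ∀ a, s(a, f a) = z → G.IsLink (e : β) a (f a) := by
    rintro _ ⟨a, rfl⟩
    obtain ⟨e, -, he⟩ := exists_lt_of_sum_lt (s := univ) (f := fun _ => (0 : ℝ))
      (by simpa [pairWeight] using hpos a)
    split_ifs at he with h
    · refine ⟨e, he, fun b hb => ?_⟩
      obtain ⟨rfl, -⟩ | ⟨rfl, h2⟩ := Sym2.eq_iff.1 hb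
      · exact h
      · rw [hf]
        exact h.symm
    · exact he.false.elim
  choose φ hφpos hφ using hex
  let ψ : G.vertexSet → G.edgeSet := fun a => φ s(a, f a) ⟨a, rfl⟩
  have hψ : ∀ a, G.IsLink (ψ a : β) a (f a) := fun a => hφ _ _ a rfl
  have hψf : ∀ a, ψ (f a) = ψ a := by
    intro a
    have : s(f a, f (f a)) = s(a, f a) := by rw [hf, Sym2.eq_swap]
    simp only [ψ, this]
  have hlink : ∀ a b c : G.vertexSet, G.IsLink (ψ c : β) a b → f a = b ∧ ψ c = ψ a := by
    intro a b c h
    obtain ⟨h1, h2⟩ | ⟨h1, h2⟩ := (hψ c).eq_and_eq_or_eq_and_eq h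
    · obtain rfl := Subtype.ext h1
      exact ⟨Subtype.ext h2, rfl⟩
    · obtain rfl := Subtype.ext h1
      obtain rfl := Subtype.ext h2
      exact ⟨hf _, (hψf _).symm⟩
  refine ⟨Set.range fun a => (ψ a : β), ⟨?_, ?_⟩, ?_, ?_⟩
  · rintro _ ⟨a, rfl⟩
    exact (ψ a).2
  · intro v hv
    refine ⟨ψ ⟨v, hv⟩, ⟨⟨_, rfl⟩, (hψ ⟨v, hv⟩).inc_left⟩, ?_⟩
    rintro _ ⟨⟨c, rfl⟩, w, hw⟩
    exact congrArg _ (hlink ⟨v, hv⟩ ⟨w, hw.right_mem⟩ c hw).2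
  · rintro e ⟨a, ha⟩
    obtain rfl := Subtype.ext ha
    exact hφpos _ _
  · ext a b
    rw [pairWeight, matchingWeight]
    split_ifs with hab
    · rw [sum_eq_single (ψ a)]
      · rw [if_pos (hab ▸ hψ a)]
        exact Set.indicator_of_mem (Set.mem_range_self a) _
      · intro e _ hne
        split_ifs with h
        · refine Set.indicator_of_notMem ?_ _
          rintro ⟨c, hc⟩
          obtain rfl := Subtype.ext hc
          exact hne (hlink a b c h).2
        · rfl
      · simp
    · refine sum_eq_zero fun e _ => ?_
      split_ifs with h
      · refine Set.indicator_of_notMem ?_ _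
        rintro ⟨c, hc⟩
        obtain rfl := Subtype.ext hc
        exact hab (hlink a b c h).1
      · rfl

lemma incidenceVector_mem_matchingPolytope [G.Loopless] [Fintype G.vertexSet]
    [DecidableEq G.vertexSet] {M : Set β} {f : G.vertexSet → G.vertexSet} (hf : f.Involutive)
    (hne : ∀ a, f a ≠ a) (hM : pairWeight (G.incidenceVector M) = matchingWeight f) :
    G.incidenceVector M ∈ G.matchingPolytope := by
  refine ⟨fun e => Set.indicator_nonneg (fun _ _ => zero_le_one) _, fun a => ?_, fun S hS => ?_⟩
  · rw [← coe_singleton, ← cutWeight_pairWeight, cutWeight_singleton (pairWeight_self _), hM]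
    simp [matchingWeight]
  · rw [← cutWeight_pairWeight, hM]
    exact one_le_cutWeight_matchingWeight hf hne hS

/-- **Edmonds' perfect matching polytope theorem**: each point of the polytope is a convex
combination of incidence vectors of perfect matchings. -/
theorem matchingPolytope_subset_convexHull [G.Loopless] [Fintype G.vertexSet] :
    G.matchingPolytope ⊆ convexHull ℝ
      {p | p ∈ G.matchingPolytope ∧ ∃ M, G.IsPerfectMatching M ∧ p = G.incidenceVector M} := by
  classical
  -- Of the equation at each vertex, only `≤` has to be added to the inequalities of the odd cuts.
  let A : G.edgeSet ⊕ G.vertexSet ⊕ {S : Finset G.vertexSet // Odd #S} → G.edgeSet → ℝ :=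
    Sum.elim (fun e => Pi.single e 1) (Sum.elim
      (fun a => -G.incidenceVector (G.cut (Subtype.val '' ({a} : Set G.vertexSet))))
      (fun S => G.incidenceVector (G.cut (Subtype.val '' ((S : Finset G.vertexSet) :
        Set G.vertexSet)))))
  let c : G.edgeSet ⊕ G.vertexSet ⊕ {S : Finset G.vertexSet // Odd #S} → ℝ :=
    Sum.elim (fun _ => 0) (Sum.elim (fun _ => -1) (fun _ => 1))
  have hmem : ∀ x : G.edgeSet → ℝ, x ∈ G.matchingPolytope ↔ ∀ i, c i ≤ A i ⬝ᵥ x := by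
    intro x
    rw [Sum.forall, Sum.forall]
    simp only [A, c, Sum.elim_inl, Sum.elim_inr, single_dotProduct, one_mul, neg_dotProduct,
      neg_le_neg_iff]
    rw [Subtype.forall (p := fun S : Finset G.vertexSet => Odd #S)]
    refine and_congr_right fun _ => ⟨fun h => ⟨fun a => (h.1 a).le, h.2⟩,
      fun h => ⟨fun a => le_antisymm (h.1 a) ?_, h.2⟩⟩
    simpa using h.2 {a} (by simp)
  have hset : G.matchingPolytope = {x | ∀ i, c i ≤ A i ⬝ᵥ x} := Set.ext hmem
  have hbdd : Bornology.IsBounded G.matchingPolytope := by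
    refine (Metric.isBounded_Icc (0 : G.edgeSet → ℝ) 1).subset fun x hx => ⟨hx.1, fun e => ?_⟩
    obtain ⟨u, v, h⟩ := G.exists_isLink_of_mem_edgeSet e.2
    rw [Pi.one_apply, ← hx.2.1 ⟨u, h.left_mem⟩]
    refine le_trans (le_of_eq ?_) (single_le_sum (f := fun e' => G.incidenceVector _ e' * x e')
      (fun e' _ => mul_nonneg (Set.indicator_nonneg (fun _ _ => zero_le_one) _) (hx.1 e'))
      (mem_univ e))
    rw [incidenceVector, Set.indicator_of_mem (mem_cut_singleton.2 h.inc_left), one_mul]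
  rw [hset] at hbdd ⊢
  refine subset_convexHull_of_forall_exists_tight A c hbdd ?_ (fun p hp => hp.1) ?_
  · refine ((Set.toFinite (Set.univ : Set (Set G.edgeSet))).image
      fun N => G.incidenceVector (Subtype.val '' N)).subset ?_
    rintro p ⟨-, M, hM, rfl⟩
    refine ⟨Subtype.val ⁻¹' M, trivial, ?_⟩
    simp only [Subtype.image_preimage_coe, Set.inter_eq_right.2 hM.1]
  · intro x hx
    rw [← hmem] at hx
    have hX := isFractionalPerfectMatching_pairWeight hx
    obtain ⟨f, hf, hfpos, hftight⟩ : ∃ f : G.vertexSet → G.vertexSet, f.Involutive ∧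
        (∀ a, 0 < pairWeight x a (f a)) ∧ ∀ S, Odd #S → cutWeight (pairWeight x) S = 1 →
          cutWeight (matchingWeight f) S = 1 := by
      cases isEmpty_or_nonempty G.vertexSet with
      | inl h =>
        exact ⟨id, fun _ => rfl, isEmptyElim, fun S hS =>
          absurd hS (by simp [Subsingleton.elim S ∅])⟩
      | inr h =>
        obtain ⟨u⟩ := h
        obtain ⟨v, -, huv⟩ := exists_lt_of_sum_lt (s := univ) (f := fun _ => (0 : ℝ))
          (g := pairWeight x u) (by simp [hX.sum_eq_one])
        obtain ⟨f, hf, -, h⟩ := hX.exists_involutive_tight huv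
        exact ⟨f, hf, h⟩
    obtain ⟨M, hM, hMx, hMf⟩ := exists_isPerfectMatching_of_involutive hf hfpos
    have hne : ∀ a, f a ≠ a := fun a h => by
      have := hfpos a
      rw [h, pairWeight_self] at this
      exact this.false
    have hp := incidenceVector_mem_matchingPolytope hf hne hMf
    refine ⟨_, ⟨(hmem _).1 hp, M, hM, rfl⟩, ?_⟩
    rintro (e | a | ⟨S, hS⟩) h
    · simp only [A, c, Sum.elim_inl, single_dotProduct, one_mul] at h ⊢
      exact Set.indicator_of_notMem (fun he => (hMx e he).ne' h) _
    · simp only [A, c, Sum.elim_inl, Sum.elim_inr, neg_dotProduct] at h ⊢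
      rw [hp.2.1]
    · simp only [A, c, Sum.elim_inr] at h ⊢
      rw [← cutWeight_pairWeight] at h ⊢
      rw [hMf]
      exact hftight S hS h

end Polytope
end Graph

/-! ### Cubic bridgeless graphs -/

namespace Graph
variable {α β : Type*} {G : Graph α β}

section Cubic

lemma cut_subset_edgeSet (S : Set α) : G.cut S ⊆ G.edgeSet := by
  rintro e ⟨a, -, b, -, h⟩
  exact h.edge_mem

/-- The edge of a cut with only one edge is a bridge. -/
lemma IsBridgeless.encard_cut_ne_one (hG : G.IsBridgeless) (S : Set α) :
    (G.cut S).encard ≠ 1 := by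
  intro h
  obtain ⟨e, he⟩ := Set.encard_eq_one.1 h
  obtain ⟨a, ha, b, hb, hab⟩ : e ∈ G.cut S := he ▸ rfl
  refine hG e hab.edge_mem ⟨a, b, hab, fun hreach => hb.2 ?_⟩
  have hinv : ∀ c, Relation.ReflTransGen (G.deleteEdges {e}).Adj a c → c ∈ S := by
    intro c hc
    induction hc with
    | refl => exact ha
    | tail _ hstep ih =>
      obtain ⟨e', he'⟩ := hstep
      rw [deleteEdges_isLink] at he'
      by_contra hS
      have : e' ∈ G.cut S := ⟨_, ih, _, ⟨he'.1.right_mem, hS⟩, he'.1⟩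
      rw [he] at this
      exact he'.2 this
  exact hinv b hreach

lemma IsCubic.finite_edgeSet (hG : G.IsCubic) (hV : G.vertexSet.Finite) : G.edgeSet.Finite := by
  refine (hV.biUnion fun v hv => Set.finite_of_encard_eq_coe (k := 3) (hG v hv)).subset
    fun e he => ?_
  obtain ⟨a, b, h⟩ := G.exists_isLink_of_mem_edgeSet he
  exact Set.mem_biUnion h.left_mem h.inc_left

lemma IsCubic.ncard_cut_singleton [G.Loopless] (hG : G.IsCubic) (a : G.vertexSet) :
    (G.cut (Subtype.val '' ({a} : Set G.vertexSet))).ncard = 3 := by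
  have h : G.cut (Subtype.val '' ({a} : Set G.vertexSet)) = G.incidenceSet a :=
    Set.ext fun e => mem_cut_singleton
  rw [h, Set.ncard, hG a a.2]
  rfl

variable [Fintype G.edgeSet]

lemma incidenceVector_dotProduct (D M : Set β) (hD : D ⊆ G.edgeSet) :
    G.incidenceVector D ⬝ᵥ G.incidenceVector M = (M ∩ D).ncard := by
  classical
  have h : ((univ.filter fun e : G.edgeSet => (e : β) ∈ M ∩ D).image Subtype.val : Finset β) =
      (M ∩ D : Set β) := by
    ext e
    simp only [coe_image, coe_filter, mem_univ, true_and, Set.mem_image, Set.mem_ofPred_eq]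
    exact ⟨by rintro ⟨e, he, rfl⟩; exact he, fun he => ⟨⟨e, hD he.2⟩, he, rfl⟩⟩
  rw [← h, Set.ncard_coe_finset, card_image_of_injective _ Subtype.val_injective, card_filter,
    Nat.cast_sum]
  refine sum_congr rfl fun e _ => ?_
  by_cases hM : (e : β) ∈ M <;> by_cases hDe : (e : β) ∈ D <;>
    simp [incidenceVector, hM, hDe]

lemma incidenceVector_dotProduct_edgeSet (D : Set β) (hD : D ⊆ G.edgeSet) :
    G.incidenceVector D ⬝ᵥ G.incidenceVector G.edgeSet = D.ncard := by
  rw [incidenceVector_dotProduct D _ hD, Set.inter_eq_right.2 hD]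

variable [Fintype G.vertexSet]

lemma IsCubic.odd_ncard_cut_iff [G.Loopless] (hG : G.IsCubic) (S : Finset G.vertexSet) :
    Odd (G.cut (Subtype.val '' (S : Set G.vertexSet))).ncard ↔ Odd #S := by
  classical
  let n : G.vertexSet → G.vertexSet → ℕ := fun a b => #{e : G.edgeSet | G.IsLink (e : β) a b}
  have hn : ∀ a b, pairWeight (G.incidenceVector G.edgeSet) a b = n a b := by
    intro a b
    simp only [pairWeight, n, card_filter, Nat.cast_sum]
    refine sum_congr rfl fun e _ => ?_
    simp [incidenceVector]
  have hcut : ∀ S : Finset G.vertexSet, (G.cut (Subtype.val '' (S : Set G.vertexSet))).ncard =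
      ∑ a ∈ S, ∑ b ∈ Sᶜ, n a b := by
    intro S
    have h := cutWeight_pairWeight (G.incidenceVector G.edgeSet) S
    rw [incidenceVector_dotProduct_edgeSet _ (cut_subset_edgeSet _)] at h
    simp only [cutWeight, hn] at h
    exact_mod_cast h.symm
  have hdiag : ∀ a, n a a = 0 := fun a => by
    exact_mod_cast (hn a a).symm.trans (pairWeight_self _ a)
  rw [hcut]
  refine odd_sum_compl_iff (fun a b => ?_) hdiag (fun a => ?_) S
  · exact_mod_cast (hn a b).symm.trans ((pairWeight_symm _ _ _).trans (hn b a))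
  · have h := hcut {a}
    rw [coe_singleton, hG.ncard_cut_singleton, sum_singleton] at h
    rw [← sum_add_sum_compl {a}, sum_singleton, hdiag, zero_add, ← h]
    decide

/-- Odd cuts have at least three edges: an odd number, and not just one. -/
lemma one_third_mem_matchingPolytope [G.Loopless] (hG : G.IsCubic) (hG' : G.IsBridgeless) :
    (1 / 3 : ℝ) • G.incidenceVector G.edgeSet ∈ G.matchingPolytope := by
  refine ⟨fun e => ?_, fun a => ?_, fun S hS => ?_⟩
  · exact mul_nonneg (by norm_num) (Set.indicator_nonneg (fun _ _ => zero_le_one) _)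
  · rw [dotProduct_smul, incidenceVector_dotProduct_edgeSet _ (cut_subset_edgeSet _),
      hG.ncard_cut_singleton]
    norm_num
  · rw [dotProduct_smul, incidenceVector_dotProduct_edgeSet _ (cut_subset_edgeSet _)]
    have hodd := (hG.odd_ncard_cut_iff S).2 hS
    have hne : (G.cut (Subtype.val '' (S : Set G.vertexSet))).ncard ≠ 1 := fun h =>
      hG'.encard_cut_ne_one _ (by
        rw [← ((Set.toFinite G.edgeSet).subset (cut_subset_edgeSet _)).cast_ncard_eq, h]
        rfl)
    have h3 : 3 ≤ (G.cut (Subtype.val '' (S : Set G.vertexSet))).ncard := by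
      rw [Nat.odd_iff] at hodd
      omega
    have h3' : (3 : ℝ) ≤ (G.cut (Subtype.val '' (S : Set G.vertexSet))).ncard := by
      exact_mod_cast h3
    rw [smul_eq_mul]
    linarith

end Cubic
end Graph

theorem mainTheorem8 {α β : Type*} (G : Graph α β) (hloopless : G.Loopless)
    (hfinite : G.vertexSet.Finite) (hcubic : G.IsCubic) (hbridgeless : G.IsBridgeless) :
    ∃ (k : ℕ) (M : Fin k → Set β) (c : Fin k → ℝ),
      (∀ i, G.IsThreeCutPerfectMatching (M i)) ∧
      (∀ i, 0 < c i) ∧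
      (1 / 3 : ℝ) • G.incidenceVector G.edgeSet = ∑ i, c i • G.incidenceVector (M i) ∧
      ∑ i, c i = 1 := by
  classical
  have : Fintype G.vertexSet := hfinite.fintype
  have hE := hcubic.finite_edgeSet hfinite
  have : Fintype G.edgeSet := hE.fintype
  obtain ⟨ι, _, z, w, hz, -, hw, hw1, hsum⟩ := eq_pos_convex_span_of_mem_convexHull
    (Graph.matchingPolytope_subset_convexHull
      (Graph.one_third_mem_matchingPolytope hcubic hbridgeless))
  choose hzQ M hM hzM using fun i => hz (Set.mem_range_self i)
  have hthree : ∀ i, G.IsThreeCutPerfectMatching (M i) := by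
    refine fun i => ⟨hM i, ?_⟩
    rintro _ ⟨⟨S, hS, rfl⟩, hcard, -⟩
    obtain ⟨T, rfl⟩ : ∃ T : Finset G.vertexSet, S = Subtype.val '' (T : Set G.vertexSet) :=
      ⟨(Subtype.val ⁻¹' S : Set G.vertexSet).toFinset, by
        rw [Set.coe_toFinset, Subtype.image_preimage_coe, Set.inter_eq_right.2 hS]⟩
    set D := G.cut (Subtype.val '' (T : Set G.vertexSet)) with hD
    have hDE : D ⊆ G.edgeSet := Graph.cut_subset_edgeSet _
    have hD3 : D.ncard = 3 := by rw [Set.ncard, hcard]; rfl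
    have hT : Odd #T := (hcubic.odd_ncard_cut_iff T).1 (by rw [← hD, hD3]; decide)
    -- The average of the numbers `#(M j ∩ D) ≥ 1` is `1`, so they all equal `1`.
    have hge : ∀ j, 1 ≤ G.incidenceVector D ⬝ᵥ z j := fun j => (hzQ j).2.2 T hT
    have havg : ∑ j, w j * (G.incidenceVector D ⬝ᵥ z j - 1) = 0 := by
      have h := congrArg (G.incidenceVector D ⬝ᵥ ·) hsum
      simp only [dotProduct_sum, dotProduct_smul, smul_eq_mul,
        Graph.incidenceVector_dotProduct_edgeSet D hDE, hD3] at h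
      simp only [mul_sub, mul_one, sum_sub_distrib, hw1, h]
      norm_num
    have hi := (sum_eq_zero_iff_of_nonneg fun j _ =>
      mul_nonneg (hw j).le (sub_nonneg.2 (hge j))).1 havg i (mem_univ i)
    have hone : G.incidenceVector D ⬝ᵥ z i = 1 := by
      linarith [(mul_eq_zero.1 hi).resolve_left (hw i).ne']
    rw [hzM, Graph.incidenceVector_dotProduct D _ hDE] at hone
    rw [← ((hE.subset hDE).subset Set.inter_subset_right).cast_ncard_eq]
    exact_mod_cast hone
  let e := Fintype.equivFin ι
  refine ⟨Fintype.card ι, M ∘ e.symm, w ∘ e.symm, fun _ => hthree _, fun _ => hw _, ?_, ?_⟩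
  · rw [← hsum]
    simp only [hzM]
    exact (e.symm.sum_comp fun i => w i • G.incidenceVector (M i)).symm
  · rw [← hw1]
    exact e.symm.sum_comp w
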